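/- **Theorem 3 (liveness of RCanopus with the Convergence Module).** *Setting.* Let $N\ge 3f+1$ and $k\ge 1$. There are $N$ Byzantine groups (BGs) and $N$ nodes of the Convergence Module (CM), one co-located with each BG. Each BG individually is safe and live: towards the outside it is a single process that follows the protocol below, and it takes its own steps (beginning a cycle, issuing a report) if they stay possible. Cycles are numbered $0,1,2,\dots$, and $k$ is the pipeline depth. Processes are asynchronous and certified statements cannot be forged. The CM nodes in some set disjoint from the quorum $Q$ below may be Byzantine. The CM nodes share a replicated state machine (RSM), given by a totally ordered log of submitted commands that every CM node executes in order. *Protocol.* A BG begins the cycles in order, and begins cycle $c\ge k$ only after it has completed cycle $c-k$; it then sends to all BGs its input for $c$, which carries its meta-data (NO_ASST, ASSISTED or DENIED) about cycle $c-k$. When it holds the inputs of at least $2f+1$ BGs (its own included) and has timed out on every BG whose input it lacks, it issues a BG_REPORT listing the inputs it holds. If all inputs are listed, the report is complete and the BG has completed the cycle (NO_ASST). Otherwise the report is a request for assistance, and the BG needs a response of its CM node, certified by the signatures of $f+1$ CM nodes: after a CM_REPLY (ASSISTED) it completes the cycle when it holds the inputs that form the output of the cycle, after a CM_DENY (DENIED)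 when it holds all inputs; it may retrieve missing inputs from any BG that has them. A CM node collects the reports for a cycle, directly or relayed by other CM nodes. After $2f+1$ reports it may time out on a BG whose report is missing and sign a suspicion; $f+1$ such signatures form a failure certificate. A CM_REPLY for cycle $c$ consists of at least $2f+1$ reports, at least one of them a request, and failure certificates for all other BGs; the output of the cycle is the set of non-failed BGs whose out-degree is at least the number of non-failed BGs minus one, in the graph on the non-failed BGs with an edge from $j$ to $i$ if $i\neq j$ reports the input of $j$. The RSM accepts only the first valid decision for each cycle. A CM_REPLY for $c$ is valid only if no cycle $\ge c+k$ has been assisted (given a CM_REPLY), and the outcome of every cycle $c'\le c-k$ is settled: $c'$ was assisted, or complete reports of $2f+1$ BGs for $c'$ are attached, or $c'$ was already settled when a cycle $\ge c'+k$ was assisted. A CM_DENY for $c$ is valid only if some cycle $\ge c+k$ has been assisted. A non-Byzantine CM node submits a reply or a denial only for a cycle for which it has received a request, only if the command is valid in its replica of the RSM, and for a reply only if it has received all attached statements; it signs exactly the decisions recorded in its replica. *Claim.* Consider any execution from the initial state in which some BG has begun cycle $C$. Let $Q$ be a quorum of at least $2f+1$ BGs, containing all but at most $f$ of the BGs (this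 is automatic if $N=3f+1$), whose CM nodes are not Byzantine. Suppose that the BGs in $Q$ and their CM nodes exchange and process messages quickly enough, that is, from some moment on no BG or CM node of $Q$ times out on a BG of $Q$, and under weak fairness (a step that stays possible is eventually taken) messages among them are delivered, the timers they run for BGs outside $Q$ expire, their CM nodes process what they receive and take their steps, and the RSM orders the commands submitted by the CM nodes of $Q$. Then every BG in $Q$ eventually begins some cycle $\ge C+k$. -/

import Mathlib

namespace RCanopus

/-! ### Messages, certificates and commands

There are `N` Byzantine groups (BGs), named by `Fin N`; the Convergence Module (CM) has one node per
BG, co-located with it and named by the same element of `Fin N`.  Cycles are natural numbers.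

Certified statements cannot be forged, and every BG is individually safe, hence acts towards the
outside as one process that certifies at most one input and at most one `BG_REPORT` per cycle.
So the hash of "the input of BG `j` in cycle `c`" carries no information beyond `(j, c)`, and a
report is given by the set of BGs whose inputs it lists.  It is *complete* if it lists all BGs, and
is a request for assistance otherwise. -/

/-- A `CM_REPLY` command for a cycle, with the certified statements on which it rests. -/
structure Reply (N : ℕ) where
  /-- the cycle whose outcome the command decides -/
  cycle : ℕ
  /-- the `BG_REPORT`s for that cycle (for each reporting BG the set of BGs it lists) -/
  reports : Fin N → Option (Finset (Fin N))
  /-- for each BG, the CM nodes whose signed suspicion of that BG in that cycle is attached -/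
  failCert : Fin N → Finset (Fin N)
  /-- pairs `(c, j)` such that a complete `BG_REPORT` of BG `j` for the earlier cycle `c` is
  attached -/
  prior : Finset (ℕ × Fin N)

namespace Reply

variable {N : ℕ}

/-- The non-failed BGs (vertices of the graph): those whose report was used.  The others form the
set `FN` of failed BGs. -/
def live (r : Reply N) : Finset (Fin N) :=
  Finset.univ.filter fun j => r.reports j ≠ none

/-- There is an edge from `j` to `i` if `i` reports that it has a copy of the input of `j`. -/
def Edge (r : Reply N) (j i : Fin N) : Prop :=
  i ≠ j ∧ ∃ R, r.reports i = some R ∧ j ∈ R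

open Classical in
/-- Out-degree of `j` in the graph of non-failed BGs. -/
noncomputable def outDegree (r : Reply N) (j : Fin N) : ℕ :=
  (r.live.filter fun i => r.Edge j i).card

open Classical in
/-- The result of the graph analysis: the maximum set of non-failed BGs whose out-degree is at least
the number of non-failed BGs minus one.  The inputs of these BGs are the output of the cycle. -/
noncomputable def outcome (r : Reply N) : Finset (Fin N) :=
  r.live.filter fun j => r.live.card - 1 ≤ r.outDegree j

/-- The BGs of which a complete report for the earlier cycle `c` is attached. -/
def completeFor (r : Reply N) (c : ℕ) : Finset (Fin N) :=
  Finset.univ.filter fun j => (c, j) ∈ r.prior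

/-- The form of a correct `CM_REPLY`: it uses at least `2f+1` reports, at least one of them a request
for assistance, and has a failure certificate (suspicions signed by `f+1` distinct CM nodes) for
every BG whose report it does not use. -/
def WellFormed (f : ℕ) (r : Reply N) : Prop :=
  2 * f + 1 ≤ r.live.card ∧
  (∃ j R, r.reports j = some R ∧ R ≠ Finset.univ) ∧
  ∀ j, j ∉ r.live → f + 1 ≤ (r.failCert j).card

end Reply

/-- Commands of the replicated state machine of the CM. -/
inductive Cmd (N : ℕ) where
  /-- `CM_REPLY` -/
  | reply (r : Reply N)
  /-- `CM_DENY` for a cycle -/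
  | deny (c : ℕ)

/-- The cycle to which a command applies. -/
def Cmd.cycle {N : ℕ} : Cmd N → ℕ
  | .reply r => r.cycle
  | .deny c => c

/-! ### The replicated state machine -/

/-- The state of the machine: for every cycle the authoritative decision, if there is one. -/
abbrev RSM (N : ℕ) := ℕ → Option (Cmd N)

/-- The CM has assisted with cycle `c`. -/
def RSM.Assisted {N : ℕ} (d : RSM N) (c : ℕ) : Prop :=
  ∃ r, d c = some (.reply r)

/-- Which commands are valid state transitions.  Only the first decision for a cycle counts.
Cycle `c` cannot be assisted once cycle `c + k` or a higher one has been assisted.  Before a cycle is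
assisted, the outcome of every cycle `c` that precedes it by `k` or more must be settled: `c` was
assisted, or `2f+1` BGs have issued complete reports for `c`, or `c` was settled when
cycle `c + k` or a higher one was assisted.  Assistance with `c` is denied if and only if it comes too
late, that is, after assistance with cycle `c + k` or a higher one. -/
def RSM.Accepts {N : ℕ} (f k : ℕ) (d : RSM N) : Cmd N → Prop
  | .reply r =>
      d r.cycle = none ∧
      (∀ c, r.cycle + k ≤ c → ¬ d.Assisted c) ∧
      r.WellFormed f ∧
      ∀ c, c + k ≤ r.cycle →
        d.Assisted c ∨ 2 * f + 1 ≤ (r.completeFor c).card ∨ ∃ c', c + k ≤ c' ∧ d.Assisted c'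
  | .deny c =>
      d c = none ∧ ∃ c', c + k ≤ c' ∧ d.Assisted c'

open Classical in
/-- One transition: a valid command is recorded, any other command is ignored. -/
noncomputable def RSM.exec {N : ℕ} (f k : ℕ) (d : RSM N) (x : Cmd N) : RSM N :=
  if d.Accepts f k x then Function.update d x.cycle (some x) else d

/-- The state after a log of commands (each tagged with the CM node that submitted it). -/
noncomputable def RSM.run {N : ℕ} (f k : ℕ) (log : List (Fin N × Cmd N)) : RSM N :=
  log.foldl (fun d x => d.exec f k x.2) (fun _ => none)

/-! ### States of the protocol -/

/-- The `BG_META` message of a BG about a past cycle. -/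
inductive Meta (N : ℕ) where
  /-- `NO_ASST`: the BG did not seek assistance -/
  | noAsst
  /-- `ASSISTED`: the BG sought assistance and received the attached `CM_REPLY` -/
  | assisted (r : Reply N)
  /-- `DENIED`: the BG sought assistance and received a `CM_DENY` -/
  | denied

/-- The input of a BG for a cycle: transactions, and meta-data about the cycle `k` cycles earlier. -/
structure Input (N : ℕ) (Tx : Type*) where
  /-- the transactions -/
  txs : Tx
  /-- the meta-data (absent in the first `k` cycles) -/
  pastMeta : Option (Meta N)

/-- A global state.  Messages that were sent are represented by the sender's state (a BG's certified
inputs and reports, a CM node's signatures), messages that were received by the receiver's state. -/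
structure State (N : ℕ) (Tx : Type*) where
  /-- BG `i`: its input for a cycle, fixed and sent to all BGs when it begins the cycle -/
  input : Fin N → ℕ → Option (Input N Tx)
  /-- BG `i`: the BGs whose inputs for the cycle it holds -/
  holds : Fin N → ℕ → Finset (Fin N)
  /-- BG `i`: the BGs on which it has timed out in the cycle -/
  timedOut : Fin N → ℕ → Finset (Fin N)
  /-- BG `i`: its `BG_REPORT` for the cycle, sent to all CM nodes -/
  report : Fin N → ℕ → Option (Finset (Fin N))
  /-- BG `i`: the response of the CM to its request for assistance with the cycle -/
  response : Fin N → ℕ → Option (Cmd N)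
  /-- CM node `m`: the BGs whose reports for the cycle it has received -/
  known : Fin N → ℕ → Finset (Fin N)
  /-- `(m, c, j)`: CM node `m` has signed (and sent to all CM nodes) that it suspects BG `j` in
  cycle `c` -/
  suspicion : Set (Fin N × ℕ × Fin N)
  /-- CM node `m`: the signed suspicions it has received -/
  suspicionKnown : Fin N → Set (Fin N × ℕ × Fin N)
  /-- `(m, x)`: CM node `m` has submitted command `x` to the replicated state machine -/
  submitted : Set (Fin N × Cmd N)
  /-- the totally ordered log of the replicated state machine -/
  log : List (Fin N × Cmd N)
  /-- CM node `m`: the number of log entries its replica has executed -/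
  executed : Fin N → ℕ
  /-- `(m, x)`: CM node `m` has signed (and sent to all CM nodes) that `x` is the authoritative
  decision for its cycle -/
  signed : Set (Fin N × Cmd N)
  /-- CM node `m`: the signatures on decisions it has received -/
  signedKnown : Fin N → Set (Fin N × Cmd N)

namespace State

variable {N : ℕ} {Tx : Type*}

/-- The initial state. -/
def init (N : ℕ) (Tx : Type*) : State N Tx where
  input _ _ := none
  holds _ _ := ∅
  timedOut _ _ := ∅
  report _ _ := none
  response _ _ := none
  known _ _ := ∅
  suspicion := ∅
  suspicionKnown _ := ∅
  submitted := ∅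
  log := []
  executed _ := 0
  signed := ∅
  signedKnown _ := ∅

/-- BG `i` has begun cycle `c` (has progressed to it). -/
def Begun (s : State N Tx) (i : Fin N) (c : ℕ) : Prop :=
  s.input i c ≠ none

/-- BG `i` has requested assistance with cycle `c`, by an incomplete report. -/
def Requests (s : State N Tx) (i : Fin N) (c : ℕ) : Prop :=
  ∃ R, s.report i c = some R ∧ R ≠ Finset.univ

/-- The meta-data of BG `i` about cycle `c`; a BG that requested assistance has none before it gets a
response. -/
def bgMeta (s : State N Tx) (i : Fin N) (c : ℕ) : Option (Meta N) :=
  match s.report i c with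
  | none => none
  | some R =>
    if R = Finset.univ then some .noAsst
    else match s.response i c with
      | none => none
      | some (.reply r) => some (.assisted r)
      | some (.deny _) => some .denied

/-- BG `i` has completed cycle `c`: either it received all inputs in time, or it was assisted and
holds the inputs that form the output of the cycle, or it was denied and holds all inputs. -/
def Completed (s : State N Tx) (i : Fin N) (c : ℕ) : Prop :=
  match s.bgMeta i c with
  | none => False
  | some .noAsst => True
  | some (.assisted r) => r.outcome ⊆ s.holds i c
  | some .denied => s.holds i c = Finset.univ

/-- The statements attached to a reply have all been made. -/
def Authentic (s : State N Tx) (r : Reply N) : Prop :=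
  (∀ j R, r.reports j = some R → s.report j r.cycle = some R) ∧
  (∀ j, ∀ m ∈ r.failCert j, (m, r.cycle, j) ∈ s.suspicion) ∧
  ∀ c j, (c, j) ∈ r.prior → s.report j c = some Finset.univ

/-- CM node `m` has received all the statements attached to a reply. -/
def Knows (s : State N Tx) (m : Fin N) (r : Reply N) : Prop :=
  (∀ j, r.reports j ≠ none → j ∈ s.known m r.cycle) ∧
  (∀ j, ∀ m' ∈ r.failCert j, (m', r.cycle, j) ∈ s.suspicionKnown m) ∧
  ∀ c j, (c, j) ∈ r.prior → j ∈ s.known m c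

/-- The state of the replica at CM node `m`. -/
noncomputable def replica (f k : ℕ) (s : State N Tx) (m : Fin N) : RSM N :=
  RSM.run f k (s.log.take (s.executed m))

/-- CM node `m` holds a certificate for the decision `x`: signatures of `f+1` distinct CM nodes. -/
def Certified (f : ℕ) (s : State N Tx) (m : Fin N) (x : Cmd N) : Prop :=
  ∃ S : Finset (Fin N), f + 1 ≤ S.card ∧ ∀ m' ∈ S, (m', x) ∈ s.signedKnown m

end State

/-! ### Steps of the protocol -/

/-- The steps. -/
inductive Action (N : ℕ) where
  /-- BG `i` begins cycle `c` and sends its input -/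
  | begin (i : Fin N) (c : ℕ)
  /-- BG `i` receives from BG `j` the input of `j` for cycle `c` -/
  | recvInput (i j : Fin N) (c : ℕ)
  /-- BG `i` times out on BG `j` in cycle `c` -/
  | timeout (i j : Fin N) (c : ℕ)
  /-- BG `i` issues its report for cycle `c` -/
  | issueReport (i : Fin N) (c : ℕ)
  /-- CM node `m` receives from BG `j` the report of `j` for cycle `c` -/
  | recvReport (m j : Fin N) (c : ℕ)
  /-- CM node `m` receives from CM node `m'` the report of BG `j` for cycle `c` -/
  | relayReport (m m' j : Fin N) (c : ℕ)
  /-- CM node `m` times out on BG `j` in cycle `c` and signs its suspicion -/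
  | suspect (m j : Fin N) (c : ℕ)
  /-- CM node `m` receives from CM node `m'` its suspicion of BG `j` in cycle `c` -/
  | recvSuspicion (m m' j : Fin N) (c : ℕ)
  /-- CM node `m` submits command `x` to the replicated state machine -/
  | submit (m : Fin N) (x : Cmd N)
  /-- the replicated state machine appends command `x`, submitted by `m`, to its log -/
  | order (m : Fin N) (x : Cmd N)
  /-- the replica at CM node `m` executes the next log entry -/
  | execute (m : Fin N)
  /-- CM node `m` signs the decision `x` -/
  | sign (m : Fin N) (x : Cmd N)
  /-- CM node `m` receives from CM node `m'` its signature on the decision `x` -/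
  | recvSignature (m m' : Fin N) (x : Cmd N)
  /-- CM node `m` gives its BG the response `x` to the request for assistance with cycle `x.cycle` -/
  | respond (m : Fin N) (x : Cmd N)
  /-- BG `i` retrieves from BG `h` a copy of the input of BG `j` for cycle `c` -/
  | retrieve (i h j : Fin N) (c : ℕ)

/-- When a step is possible.  The CM nodes in `byz` are Byzantine: they may sign any suspicion and any
decision, and may submit any command in which no statement of another party is forged. -/
def Enabled {N : ℕ} {Tx : Type*} (f k : ℕ) (byz : Finset (Fin N)) (s : State N Tx) :
    Action N → Prop
  | .begin i c =>
      -- cycles are begun in order, and cycle `c` only after completion of cycle `c - k`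
      ¬ s.Begun i c ∧ (∀ c' < c, s.Begun i c') ∧ ∀ c', c' + k = c → s.Completed i c'
  | .recvInput i j c => s.Begun j c ∧ j ∉ s.holds i c
  | .timeout i j c =>
      s.Begun i c ∧ s.report i c = none ∧ j ∉ s.holds i c ∧ j ∉ s.timedOut i c
  | .issueReport i c =>
      s.Begun i c ∧ s.report i c = none ∧ 2 * f + 1 ≤ (s.holds i c).card ∧
      ∀ j, j ∈ s.holds i c ∨ j ∈ s.timedOut i c
  | .recvReport m j c => s.report j c ≠ none ∧ j ∉ s.known m c
  | .relayReport m m' j c => j ∈ s.known m' c ∧ j ∉ s.known m c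
  | .suspect m j c =>
      (m, c, j) ∉ s.suspicion ∧
      (m ∈ byz ∨ (2 * f + 1 ≤ (s.known m c).card ∧ j ∉ s.known m c))
  | .recvSuspicion m m' j c =>
      (m', c, j) ∈ s.suspicion ∧ (m', c, j) ∉ s.suspicionKnown m
  | .submit m (.reply r) =>
      (m, .reply r) ∉ s.submitted ∧ s.Authentic r ∧
      (m ∈ byz ∨ (s.Knows m r ∧ (s.replica f k m).Accepts f k (.reply r)))
  | .submit m (.deny c) =>
      (m, .deny c) ∉ s.submitted ∧
      (m ∈ byz ∨
        ((∃ j ∈ s.known m c, s.Requests j c) ∧ (s.replica f k m).Accepts f k (.deny c)))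
  | .order m x => (m, x) ∈ s.submitted ∧ (m, x) ∉ s.log
  | .execute m => s.executed m < s.log.length
  | .sign m x =>
      (m, x) ∉ s.signed ∧ (m ∈ byz ∨ s.replica f k m x.cycle = some x)
  | .recvSignature m m' x => (m', x) ∈ s.signed ∧ (m', x) ∉ s.signedKnown m
  | .respond m x =>
      m ∈ s.known m x.cycle ∧ s.Requests m x.cycle ∧ s.response m x.cycle = none ∧
      s.Certified f m x
  | .retrieve i h j c =>
      s.response i c ≠ none ∧ j ∈ s.holds h c ∧ j ∉ s.holds i c

/-- Change of a table at one entry. -/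
def upd {N : ℕ} {α : Type*} (g : Fin N → ℕ → α) (i : Fin N) (c : ℕ) (v : α) :
    Fin N → ℕ → α :=
  fun i' c' => if i' = i ∧ c' = c then v else g i' c'

/-- The effect of a step; `txs i c` are the transactions of BG `i` for cycle `c`, on which its
members agree among themselves. -/
def effect {N : ℕ} {Tx : Type*} (k : ℕ) (txs : Fin N → ℕ → Tx) (s : State N Tx) :
    Action N → State N Tx
  | .begin i c =>
      { s with
        input := upd s.input i c
          (some ⟨txs i c, if k ≤ c then s.bgMeta i (c - k) else none⟩)
        holds := upd s.holds i c (insert i (s.holds i c)) }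
  | .recvInput i j c => { s with holds := upd s.holds i c (insert j (s.holds i c)) }
  | .timeout i j c => { s with timedOut := upd s.timedOut i c (insert j (s.timedOut i c)) }
  | .issueReport i c => { s with report := upd s.report i c (some (s.holds i c)) }
  | .recvReport m j c => { s with known := upd s.known m c (insert j (s.known m c)) }
  | .relayReport m _ j c => { s with known := upd s.known m c (insert j (s.known m c)) }
  | .suspect m j c => { s with suspicion := insert (m, c, j) s.suspicion }
  | .recvSuspicion m m' j c =>
      { s with suspicionKnown :=
          Function.update s.suspicionKnown m (insert (m', c, j) (s.suspicionKnown m)) }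
  | .submit m x => { s with submitted := insert (m, x) s.submitted }
  | .order m x => { s with log := s.log ++ [(m, x)] }
  | .execute m => { s with executed := Function.update s.executed m (s.executed m + 1) }
  | .sign m x => { s with signed := insert (m, x) s.signed }
  | .recvSignature m m' x =>
      { s with signedKnown :=
          Function.update s.signedKnown m (insert (m', x) (s.signedKnown m)) }
  | .respond m x => { s with response := upd s.response m x.cycle (some x) }
  | .retrieve i _ j c => { s with holds := upd s.holds i c (insert j (s.holds i c)) }

/-! ### Executions and fairness -/

/-- An execution from the initial state; `none` is a moment at which nothing happens. -/
structure Execution (N f k : ℕ) {Tx : Type*} (txs : Fin N → ℕ → Tx) (byz : Finset (Fin N)) where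
  /-- the state at each moment -/
  state : ℕ → State N Tx
  /-- the step taken at each moment -/
  act : ℕ → Option (Action N)
  start : state 0 = State.init N Tx
  idle : ∀ t, act t = none → state (t + 1) = state t
  step : ∀ t a, act t = some a →
    Enabled f k byz (state t) a ∧ state (t + 1) = effect k txs (state t) a

namespace Execution

variable {N f k : ℕ} {Tx : Type*} {txs : Fin N → ℕ → Tx} {byz : Finset (Fin N)}

/-- Weak fairness: the step `a` is not possible forever without being taken. -/
def Fair (e : Execution N f k txs byz) (a : Action N) : Prop :=
  ∀ t, ∃ t' ≥ t, ¬ Enabled f k byz (e.state t') a ∨ e.act t' = some a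

/-- BG `i` is individually live: it takes those of its steps that depend on its own
members only. -/
structure BGLive (e : Execution N f k txs byz) (i : Fin N) : Prop where
  begins : ∀ c, e.Fair (.begin i c)
  reports : ∀ c, e.Fair (.issueReport i c)

/-- From the moment `t₀` on, the BGs in `Q` and their CM nodes exchange and process messages quickly
enough that none of them times out on a BG in `Q`.  Messages among them arrive, the
timers they run for other BGs expire, their CM nodes process what they receive, and the
replicated state machine orders the commands that their CM nodes submit. -/
structure Timely (e : Execution N f k txs byz) (Q : Finset (Fin N)) (t₀ : ℕ) : Prop where
  no_timeout : ∀ t ≥ t₀, ∀ i ∈ Q, ∀ j ∈ Q, ∀ c, e.act t ≠ some (.timeout i j c)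
  no_suspicion : ∀ t ≥ t₀, ∀ m ∈ Q, ∀ j ∈ Q, ∀ c, e.act t ≠ some (.suspect m j c)
  recvInput : ∀ i ∈ Q, ∀ j ∈ Q, ∀ c, e.Fair (.recvInput i j c)
  timeout : ∀ i ∈ Q, ∀ j ∉ Q, ∀ c, e.Fair (.timeout i j c)
  recvReport : ∀ m ∈ Q, ∀ j ∈ Q, ∀ c, e.Fair (.recvReport m j c)
  relayReport : ∀ m ∈ Q, ∀ m' ∈ Q, ∀ j c, e.Fair (.relayReport m m' j c)
  suspect : ∀ m ∈ Q, ∀ j ∉ Q, ∀ c, e.Fair (.suspect m j c)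
  recvSuspicion : ∀ m ∈ Q, ∀ m' ∈ Q, ∀ j c, e.Fair (.recvSuspicion m m' j c)
  submit : ∀ m ∈ Q, ∀ x, e.Fair (.submit m x)
  order : ∀ m ∈ Q, ∀ x, e.Fair (.order m x)
  execute : ∀ m ∈ Q, e.Fair (.execute m)
  sign : ∀ m ∈ Q, ∀ x, e.Fair (.sign m x)
  recvSignature : ∀ m ∈ Q, ∀ m' ∈ Q, ∀ x, e.Fair (.recvSignature m m' x)
  respond : ∀ m ∈ Q, ∀ x, e.Fair (.respond m x)
  retrieve : ∀ i ∈ Q, ∀ h ∈ Q, ∀ j c, e.Fair (.retrieve i h j c)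

end Execution

end RCanopus

/-! The BGs of `Q` in fact begin every cycle, by strong induction on the cycle (`eventually_begun`).
Beginning `c` requires completion of `c - k`, so the core is that a cycle begun by all of `Q` is
completed by all of `Q` (`eventually_completed`).

The tool throughout is monotonicity. States only grow, so a step whose preconditions are lasting
stays possible until its goal is reached, and weak fairness then gives the goal for good
(`Fair.eventually`).

The danger is that a request for assistance stays undecided. Validity of a command is not monotone,
but it is the conjunction of a monotone condition, `Ready`, with the negation of another one,
`Obsolete`; executing a ready command makes it obsolete. Suppose that cycle `c` is requested but
never decided. If a cycle `≥ c + k` is ever assisted, a denial stays valid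
(`exists_decided_of_later`). Otherwise a reply can be built from the reports that reach `Q` and the
suspicions of `Q` (`exists_decided_of_not_later`); earlier cycles are settled because `Q` could not
have begun `c` without completing them (`eventually_settled`). Either command is ordered and thus
becomes obsolete, a contradiction.

Among the `f + 1` signers of a response one is in `Q`, so responses agree with the state machine
(`run_of_response`). The inputs still needed are available in `Q`: a member of the outcome outside
`Q` is listed by a reporting BG of `Q` (`edge_of_mem_outcome`), and a denial presupposes a later
assisted cycle, hence a BG of `Q` that got past `c` holding all inputs
(`exists_holds_univ_of_denied`). -/

namespace RCanopus

/-! ### The replicated state machine -/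

namespace RSM

variable {N f k : ℕ}

/-- Every decision of `d` is a decision of `d'`. -/
def Extends (d d' : RSM N) : Prop :=
  ∀ c x, d c = some x → d' c = some x

theorem Extends.assisted {d d' : RSM N} (h : d.Extends d') {c : ℕ} (hc : d.Assisted c) :
    d'.Assisted c :=
  hc.imp fun _ hr => h _ _ hr

theorem Accepts.eq_none {d : RSM N} {x : Cmd N} (h : d.Accepts f k x) : d x.cycle = none := by
  cases x <;> exact h.1

theorem extends_exec (d : RSM N) (x : Cmd N) : d.Extends (d.exec f k x) := by
  intro c y hy
  unfold exec
  split_ifs with h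
  · have hne : c ≠ x.cycle := by
      rintro rfl
      rw [h.eq_none] at hy
      cases hy
    rw [Function.update_of_ne hne, hy]
  · exact hy

theorem exec_of_accepts {d : RSM N} {x : Cmd N} (h : d.Accepts f k x) :
    d.exec f k x x.cycle = some x := by
  simp [exec, h]

theorem run_append_singleton (log : List (Fin N × Cmd N)) (p : Fin N × Cmd N) :
    run f k (log ++ [p]) = (run f k log).exec f k p.2 := by
  simp [run]

theorem extends_run_append (log l : List (Fin N × Cmd N)) :
    (run f k log).Extends (run f k (log ++ l)) := by
  induction l using List.reverseRecOn with
  | nil => intro c x h; simpa using h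
  | append_singleton l p ih =>
    rw [← List.append_assoc, run_append_singleton]
    exact fun c x h => extends_exec _ _ _ _ (ih c x h)

theorem extends_run_of_prefix {log log' : List (Fin N × Cmd N)} (h : log <+: log') :
    (run f k log).Extends (run f k log') := by
  obtain ⟨l, rfl⟩ := h
  exact extends_run_append log l

/-- What makes a command valid, apart from its not coming too late. -/
def Ready (f k : ℕ) (d : RSM N) : Cmd N → Prop
  | .reply r => r.WellFormed f ∧ ∀ c, c + k ≤ r.cycle →
      d.Assisted c ∨ 2 * f + 1 ≤ (r.completeFor c).card ∨ ∃ c', c + k ≤ c' ∧ d.Assisted c'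
  | .deny c => ∃ c', c + k ≤ c' ∧ d.Assisted c'

theorem Accepts.ready {d : RSM N} {x : Cmd N} (h : d.Accepts f k x) : d.Ready f k x := by
  cases x with
  | reply r => exact h.2.2
  | deny c => exact h.2

/-- `Assisted` occurs only positively in `Ready`. Hence a condition checked at a lagging replica
still holds for the whole log. -/
theorem Ready.mono {d d' : RSM N} {x : Cmd N} (h : d.Ready f k x) (hd : d.Extends d') :
    d'.Ready f k x := by
  cases x with
  | reply r =>
    refine ⟨h.1, fun c hc => ?_⟩
    rcases h.2 c hc with h | h | ⟨c', h, h'⟩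
    · exact Or.inl (hd.assisted h)
    · exact Or.inr (Or.inl h)
    · exact Or.inr (Or.inr ⟨c', h, hd.assisted h'⟩)
  | deny c =>
    obtain ⟨c', h, h'⟩ := h
    exact ⟨c', h, hd.assisted h'⟩

/-- Command `x` needs no further execution: its cycle is decided, or it is a reply that comes too
late. -/
def Obsolete (k : ℕ) (d : RSM N) (x : Cmd N) : Prop :=
  d x.cycle ≠ none ∨ ∃ r, x = .reply r ∧ ∃ c, r.cycle + k ≤ c ∧ d.Assisted c

theorem Obsolete.mono {d d' : RSM N} {x : Cmd N} (h : d.Obsolete k x) (hd : d.Extends d') :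
    d'.Obsolete k x := by
  rcases h with h | ⟨r, rfl, c, hc, h⟩
  · obtain ⟨y, hy⟩ := Option.ne_none_iff_exists'.1 h
    exact Or.inl (by rw [hd _ _ hy]; simp)
  · exact Or.inr ⟨r, rfl, c, hc, hd.assisted h⟩

/-- `Obsolete` collects exactly the ways in which growth of the machine can invalidate a command;
for a denial the only one is that its cycle gets decided. -/
theorem Ready.accepts {d : RSM N} {x : Cmd N} (h : d.Ready f k x) (hx : ¬ d.Obsolete k x) :
    d.Accepts f k x := by
  simp only [Obsolete, not_or, not_not] at hx
  cases x with
  | reply r => exact ⟨hx.1, fun c hc hA => hx.2 ⟨r, rfl, c, hc, hA⟩, h⟩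
  | deny c => exact ⟨hx.1, h⟩

/-- The progress property of the machine: a ready command is ignored only if it was already
obsolete, so ordering it never leaves its cycle open without cause. -/
theorem Ready.obsolete_exec {d : RSM N} {x : Cmd N} (h : d.Ready f k x) :
    (d.exec f k x).Obsolete k x := by
  by_cases hx : d.Obsolete k x
  · exact hx.mono (extends_exec d x)
  · exact Or.inl (by rw [exec_of_accepts (h.accepts hx)]; simp)

/-- Decisions of the machine come from the log, and the conditions for them still hold. -/
theorem run_spec {log : List (Fin N × Cmd N)} {c : ℕ} {x : Cmd N}
    (h : run f k log c = some x) :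
    x.cycle = c ∧ (∃ m, (m, x) ∈ log) ∧ (run f k log).Ready f k x := by
  induction log using List.reverseRecOn with
  | nil => simp [run] at h
  | append_singleton l p ih =>
    have hext := extends_run_append (f := f) (k := k) l [p]
    by_cases hl : run f k l c = some x
    · obtain ⟨h1, ⟨m, hm⟩, h3⟩ := ih hl
      exact ⟨h1, ⟨m, by simp [hm]⟩, h3.mono hext⟩
    · have h' := h
      rw [run_append_singleton, exec] at h'
      split_ifs at h' with hacc
      · by_cases hc : c = p.2.cycle
        · subst hc
          rw [Function.update_self] at h'
          cases h'
          exact ⟨rfl, ⟨p.1, by simp⟩, hacc.ready.mono hext⟩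
        · rw [Function.update_of_ne hc] at h'
          exact absurd h' hl
      · exact absurd h' hl

end RSM

/-! ### Growth of states -/

namespace State

variable {N f k : ℕ} {Tx : Type*}

/-- State `s'` contains everything that state `s` contains. -/
structure Grows (s s' : State N Tx) : Prop where
  input : ∀ i c v, s.input i c = some v → s'.input i c = some v
  holds : ∀ i c, s.holds i c ⊆ s'.holds i c
  timedOut : ∀ i c, s.timedOut i c ⊆ s'.timedOut i c
  report : ∀ i c R, s.report i c = some R → s'.report i c = some R
  response : ∀ i c x, s.response i c = some x → s'.response i c = some x
  known : ∀ m c, s.known m c ⊆ s'.known m c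
  suspicion : s.suspicion ⊆ s'.suspicion
  suspicionKnown : ∀ m, s.suspicionKnown m ⊆ s'.suspicionKnown m
  submitted : s.submitted ⊆ s'.submitted
  log : s.log <+: s'.log
  executed : ∀ m, s.executed m ≤ s'.executed m
  signed : s.signed ⊆ s'.signed
  signedKnown : ∀ m, s.signedKnown m ⊆ s'.signedKnown m

theorem Grows.refl (s : State N Tx) : s.Grows s := by
  constructor <;> simp

theorem Grows.trans {s s' s'' : State N Tx} (h : s.Grows s') (h' : s'.Grows s'') :
    s.Grows s'' where
  input i c v hv := h'.input i c v (h.input i c v hv)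
  holds i c := (h.holds i c).trans (h'.holds i c)
  timedOut i c := (h.timedOut i c).trans (h'.timedOut i c)
  report i c v hv := h'.report i c v (h.report i c v hv)
  response i c v hv := h'.response i c v (h.response i c v hv)
  known i c := (h.known i c).trans (h'.known i c)
  suspicion := h.suspicion.trans h'.suspicion
  suspicionKnown m := (h.suspicionKnown m).trans (h'.suspicionKnown m)
  submitted := h.submitted.trans h'.submitted
  log := h.log.trans h'.log
  executed m := (h.executed m).trans (h'.executed m)
  signed := h.signed.trans h'.signed
  signedKnown m := (h.signedKnown m).trans (h'.signedKnown m)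

theorem Grows.begun {s s' : State N Tx} (h : s.Grows s') {i : Fin N} {c : ℕ}
    (hb : s.Begun i c) : s'.Begun i c := by
  obtain ⟨v, hv⟩ := Option.ne_none_iff_exists'.1 hb
  simp [Begun, h.input i c v hv]

theorem Grows.report_ne_none {s s' : State N Tx} (h : s.Grows s') {i : Fin N} {c : ℕ}
    (hb : s.report i c ≠ none) : s'.report i c ≠ none := by
  obtain ⟨v, hv⟩ := Option.ne_none_iff_exists'.1 hb
  simp [h.report i c v hv]

theorem Grows.requests {s s' : State N Tx} (h : s.Grows s') {i : Fin N} {c : ℕ}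
    (hb : s.Requests i c) : s'.Requests i c :=
  hb.imp fun _ hR => ⟨h.report _ _ _ hR.1, hR.2⟩

theorem Grows.authentic {s s' : State N Tx} (h : s.Grows s') {r : Reply N}
    (hr : s.Authentic r) : s'.Authentic r :=
  ⟨fun j R hR => h.report _ _ _ (hr.1 j R hR), fun j m hm => h.suspicion (hr.2.1 j m hm),
    fun c j hj => h.report _ _ _ (hr.2.2 c j hj)⟩

theorem Grows.run {s s' : State N Tx} (h : s.Grows s') :
    (RSM.run f k s.log).Extends (RSM.run f k s'.log) :=
  RSM.extends_run_of_prefix h.log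

theorem replica_extends (s : State N Tx) (m : Fin N) :
    (s.replica f k m).Extends (RSM.run f k s.log) :=
  RSM.extends_run_of_prefix (List.take_prefix _ _)

/-- The right-hand side is built from positive, growing facts, which makes monotonicity of
completion visible. -/
theorem completed_iff {s : State N Tx} {i : Fin N} {c : ℕ} :
    s.Completed i c ↔ ∃ R, s.report i c = some R ∧ (R = Finset.univ ∨
      (∃ r, s.response i c = some (.reply r) ∧ r.outcome ⊆ s.holds i c) ∨
      ∃ c', s.response i c = some (.deny c') ∧ s.holds i c = Finset.univ) := by
  unfold Completed bgMeta
  rcases hR : s.report i c with _ | R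
  · simp
  · by_cases hu : R = Finset.univ
    · simp [hu]
    · rcases hx : s.response i c with _ | (r | c') <;> simp [hu]

theorem Grows.completed {s s' : State N Tx} (h : s.Grows s') {i : Fin N} {c : ℕ}
    (hc : s.Completed i c) : s'.Completed i c := by
  rw [completed_iff] at hc ⊢
  obtain ⟨R, hR, hc⟩ := hc
  refine ⟨R, h.report _ _ _ hR, ?_⟩
  rcases hc with hu | ⟨r, hr, hc⟩ | ⟨c', hr, hc⟩
  · exact Or.inl hu
  · exact Or.inr (Or.inl ⟨r, h.response _ _ _ hr, hc.trans (h.holds i c)⟩)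
  · exact Or.inr (Or.inr ⟨c', h.response _ _ _ hr, Finset.univ_subset_iff.1 (hc ▸ h.holds i c)⟩)

end State

open State

variable {N f k : ℕ} {Tx : Type*} {byz : Finset (Fin N)}

/-! ### / Updates of tables, and monotonicity of steps -/

theorem subset_upd_insert (g : Fin N → ℕ → Finset (Fin N)) (i j : Fin N) (c : ℕ)
    (i' : Fin N) (c' : ℕ) : g i' c' ⊆ upd g i c (insert j (g i c)) i' c' := by
  unfold upd
  split_ifs with h
  · rw [h.1, h.2]
    exact Finset.subset_insert _ _
  · exact subset_rfl

theorem mem_upd_insert {g : Fin N → ℕ → Finset (Fin N)} {i j i' j' : Fin N} {c c' : ℕ} :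
    j' ∈ upd g i c (insert j (g i c)) i' c' ↔ (i' = i ∧ c' = c ∧ j' = j) ∨ j' ∈ g i' c' := by
  unfold upd
  split_ifs with h
  · obtain ⟨rfl, rfl⟩ := h
    simp
  · have : ¬ (i' = i ∧ c' = c ∧ j' = j) := fun h' => h ⟨h'.1, h'.2.1⟩
    simp [this]

theorem upd_some_eq_some {α : Type*} {g : Fin N → ℕ → Option α} {i i' : Fin N} {c c' : ℕ}
    {v w : α} : upd g i c (some v) i' c' = some w ↔
      (i' = i ∧ c' = c ∧ v = w) ∨ (¬ (i' = i ∧ c' = c) ∧ g i' c' = some w) := by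
  unfold upd
  split_ifs with h
  · simp [h]
  · simp [h]
    grind

theorem upd_preserves {α : Type*} {g : Fin N → ℕ → Option α} {i i' : Fin N} {c c' : ℕ}
    {v w : α} (hg : g i c = none) (h : g i' c' = some w) :
    upd g i c (some v) i' c' = some w := by
  rw [upd_some_eq_some]
  refine Or.inr ⟨?_, h⟩
  rintro ⟨rfl, rfl⟩
  rw [hg] at h
  cases h

theorem subset_update_insert {α : Type*} (g : Fin N → Set α) (m : Fin N) (a : α) (m' : Fin N) :
    g m' ⊆ Function.update g m (insert a (g m)) m' := by
  by_cases h : m' = m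
  · subst h
    simp
  · simp [h]

theorem mem_update_insert {α : Type*} {g : Fin N → Set α} {m m' : Fin N} {a b : α} :
    b ∈ Function.update g m (insert a (g m)) m' ↔ (m' = m ∧ b = a) ∨ b ∈ g m' := by
  by_cases h : m' = m
  · subst h
    simp
  · simp [h]

/-- Sets, counters and the log only increase; inputs, reports and responses are write-once, because
the guards of the steps that write them require the entry to be `none`. -/
theorem grows_effect (txs : Fin N → ℕ → Tx) {s : State N Tx} {a : Action N}
    (h : Enabled f k byz s a) : s.Grows (effect k txs s a) := by
  have h0 := Grows.refl s
  cases a with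
  | begin i c =>
    exact { h0 with
      input := fun _ _ _ => upd_preserves (not_not.1 h.1)
      holds := subset_upd_insert _ _ _ _ }
  | recvInput i j c => exact { h0 with holds := subset_upd_insert _ _ _ _ }
  | timeout i j c => exact { h0 with timedOut := subset_upd_insert _ _ _ _ }
  | issueReport i c => exact { h0 with report := fun _ _ _ => upd_preserves h.2.1 }
  | recvReport m j c => exact { h0 with known := subset_upd_insert _ _ _ _ }
  | relayReport m m' j c => exact { h0 with known := subset_upd_insert _ _ _ _ }
  | suspect m j c => exact { h0 with suspicion := Set.subset_insert _ _ }
  | recvSuspicion m m' j c => exact { h0 with suspicionKnown := subset_update_insert _ _ _ }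
  | submit m x => exact { h0 with submitted := Set.subset_insert _ _ }
  | order m x => exact { h0 with log := List.prefix_append _ _ }
  | execute m =>
    refine { h0 with executed := fun m' => ?_ }
    by_cases hm : m' = m
    · subst hm
      simp [effect]
    · simp [effect, hm]
  | sign m x => exact { h0 with signed := Set.subset_insert _ _ }
  | recvSignature m m' x => exact { h0 with signedKnown := subset_update_insert _ _ _ }
  | respond m x => exact { h0 with response := fun _ _ _ => upd_preserves h.2.2.1 }
  | retrieve i h' j c => exact { h0 with holds := subset_upd_insert _ _ _ _ }

/-! ### Invariants -/

/-- Facts that hold in every reachable state. -/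
structure Invariant (f k : ℕ) (byz : Finset (Fin N)) (s : State N Tx) : Prop where
  begun_lt : ∀ i c, s.Begun i c → ∀ c' < c, s.Begun i c'
  begun_completed : ∀ i c, s.Begun i (c + k) → s.Completed i c
  report_begun : ∀ i c, s.report i c ≠ none → s.Begun i c
  report_subset : ∀ i c R, s.report i c = some R → R ⊆ s.holds i c
  response_cycle : ∀ i c x, s.response i c = some x → x.cycle = c
  response_certified : ∀ i c x, s.response i c = some x → s.Certified f i x
  known_report : ∀ m c, ∀ j ∈ s.known m c, s.report j c ≠ none
  submitted_authentic : ∀ m r, (m, .reply r) ∈ s.submitted → s.Authentic r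
  submitted_ready : ∀ m x, m ∉ byz → (m, x) ∈ s.submitted → (RSM.run f k s.log).Ready f k x
  log_submitted : ∀ p ∈ s.log, p ∈ s.submitted
  log_obsolete : ∀ m x, m ∉ byz → (m, x) ∈ s.log → (RSM.run f k s.log).Obsolete k x
  executed_le : ∀ m, s.executed m ≤ s.log.length
  signed_decided : ∀ m x, m ∉ byz → (m, x) ∈ s.signed → RSM.run f k s.log x.cycle = some x
  signedKnown_signed : ∀ m, s.signedKnown m ⊆ s.signed

theorem invariant_init : Invariant f k byz (State.init N Tx) := by
  constructor <;> simp [State.init, Begun]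

theorem Invariant.effect (txs : Fin N → ℕ → Tx) {s : State N Tx} {a : Action N}
    (I : Invariant f k byz s) (h : Enabled f k byz s a) :
    Invariant f k byz (effect k txs s a) := by
  have G := grows_effect txs h
  -- Inputs, reports, responses and submissions are each written by a single kind of step. The case
  -- distinctions isolate it, so that old entries are handled by monotonicity and new ones by the
  -- guard.
  have begun_cases : ∀ i c, (RCanopus.effect k txs s a).Begun i c →
      s.Begun i c ∨ a = .begin i c := by
    intro i c hb
    cases a <;> try exact Or.inl hb
    rename_i i' c'
    obtain ⟨v, hv⟩ := Option.ne_none_iff_exists'.1 hb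
    rcases upd_some_eq_some.1 hv with ⟨rfl, rfl, -⟩ | ⟨-, hv⟩
    · exact Or.inr rfl
    · exact Or.inl (by simp [Begun, hv])
  have report_cases : ∀ i c R, (RCanopus.effect k txs s a).report i c = some R →
      s.report i c = some R ∨ (a = .issueReport i c ∧ R = s.holds i c) := by
    intro i c R hR
    cases a <;> try exact Or.inl hR
    rename_i i' c'
    rcases upd_some_eq_some.1 hR with ⟨rfl, rfl, hv⟩ | ⟨-, hv⟩
    · exact Or.inr ⟨rfl, hv.symm⟩
    · exact Or.inl hv
  have response_cases : ∀ i c x, (RCanopus.effect k txs s a).response i c = some x →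
      s.response i c = some x ∨ (a = .respond i x ∧ c = x.cycle) := by
    intro i c R hR
    cases a <;> try exact Or.inl hR
    rename_i i' x'
    rcases upd_some_eq_some.1 hR with ⟨rfl, hc, rfl⟩ | ⟨-, hv⟩
    · exact Or.inr ⟨rfl, hc⟩
    · exact Or.inl hv
  have certified_mono : ∀ i x, s.Certified f i x →
      (RCanopus.effect k txs s a).Certified f i x := fun i x ⟨S, h1, h2⟩ =>
    ⟨S, h1, fun m hm => G.signedKnown i (h2 m hm)⟩
  have submitted_cases : ∀ p, p ∈ (RCanopus.effect k txs s a).submitted →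
      p ∈ s.submitted ∨ a = .submit p.1 p.2 := by
    intro p hp
    cases a <;> try exact Or.inl hp
    rcases hp with rfl | hp
    · exact Or.inr rfl
    · exact Or.inl hp
  refine ⟨?_, ?_, ?_, ?_, ?_, ?_, ?_, ?_, ?_, ?_, ?_, ?_, ?_, ?_⟩
  · intro i c hb c' hc'
    rcases begun_cases i c hb with hb | rfl
    · exact G.begun (I.begun_lt i c hb c' hc')
    · exact G.begun (h.2.1 c' hc')
  · intro i c hb
    rcases begun_cases i _ hb with hb | rfl
    · exact G.completed (I.begun_completed i c hb)
    · exact G.completed (h.2.2 c rfl)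
  · intro i c hr
    obtain ⟨R, hR⟩ := Option.ne_none_iff_exists'.1 hr
    rcases report_cases i c R hR with hR | ⟨rfl, -⟩
    · exact G.begun (I.report_begun i c (by simp [hR]))
    · exact G.begun h.1
  · intro i c R hR
    rcases report_cases i c R hR with hR | ⟨rfl, rfl⟩
    · exact (I.report_subset i c R hR).trans (G.holds i c)
    · exact G.holds i c
  · intro i c x hx
    rcases response_cases i c x hx with hx | ⟨-, rfl⟩
    · exact I.response_cycle i c x hx
    · rfl
  · intro i c x hx
    rcases response_cases i c x hx with hx | ⟨rfl, rfl⟩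
    · exact certified_mono i x (I.response_certified i c x hx)
    · exact certified_mono i x h.2.2.2
  · intro m c j hj
    have : j ∈ s.known m c ∨ s.report j c ≠ none := by
      cases a <;> try exact Or.inl hj
      · rcases mem_upd_insert.1 hj with ⟨rfl, rfl, rfl⟩ | hj
        · exact Or.inr h.1
        · exact Or.inl hj
      · rcases mem_upd_insert.1 hj with ⟨rfl, rfl, rfl⟩ | hj
        · exact Or.inr (I.known_report _ _ _ h.1)
        · exact Or.inl hj
    rcases this with hj | hj
    · exact G.report_ne_none (I.known_report m c j hj)
    · exact G.report_ne_none hj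
  · intro m r hp
    rcases submitted_cases _ hp with hp | rfl
    · exact G.authentic (I.submitted_authentic m r hp)
    · exact G.authentic h.2.1
  · intro m x hm hp
    rcases submitted_cases _ hp with hp | rfl
    · exact (I.submitted_ready m x hm hp).mono G.run
    · have : (s.replica f k m).Accepts f k x := by
        cases x with
        | reply r => exact (h.2.2.resolve_left hm).2
        | deny c => exact (h.2.resolve_left hm).2
      exact (this.ready.mono (s.replica_extends m)).mono G.run
  · intro p hp
    have : p ∈ s.log ∨ p ∈ s.submitted := by
      cases a <;> try exact Or.inl hp
      rcases List.mem_append.1 hp with hp | hp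
      · exact Or.inl hp
      · rw [List.mem_singleton.1 hp]
        exact Or.inr h.1
    exact G.submitted (this.elim (I.log_submitted p) id)
  · intro m x hm hp
    have : (m, x) ∈ s.log ∨ a = .order m x := by
      cases a <;> try exact Or.inl hp
      rcases List.mem_append.1 hp with hp | hp
      · exact Or.inl hp
      · cases List.mem_singleton.1 hp
        exact Or.inr rfl
    rcases this with hp | rfl
    · exact (I.log_obsolete m x hm hp).mono G.run
    -- The command may have been submitted long ago; readiness has survived until this moment of
    -- ordering.
    · have := (I.submitted_ready m x hm h.1).obsolete_exec
      simpa only [RCanopus.effect, RSM.run_append_singleton] using this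
  · intro m
    by_cases ha : a = .execute m
    · subst ha
      have h : s.executed m < s.log.length := h
      simpa [RCanopus.effect] using h
    · have : (RCanopus.effect k txs s a).executed m = s.executed m := by
        cases a <;> try rfl
        rename_i m'
        have hm : m ≠ m' := by
          rintro rfl
          exact ha rfl
        simp [RCanopus.effect, hm]
      rw [this]
      exact (I.executed_le m).trans G.log.length_le
  · intro m x hm hp
    have : (m, x) ∈ s.signed ∨ a = .sign m x := by
      cases a <;> try exact Or.inl hp
      rcases hp with hp | hp
      · cases hp
        exact Or.inr rfl
      · exact Or.inl hp
    rcases this with hp | rfl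
    · exact G.run _ _ (I.signed_decided m x hm hp)
    -- A replica executes a prefix of the log, so what it has recorded is also the decision of the
    -- full log.
    · exact G.run _ _ (s.replica_extends m _ _ (h.2.resolve_left hm))
  · intro m p hp
    have : p ∈ s.signedKnown m ∨ p ∈ s.signed := by
      cases a <;> try exact Or.inl hp
      rcases mem_update_insert.1 hp with ⟨rfl, rfl⟩ | hp
      · exact Or.inr h.1
      · exact Or.inl hp
    exact G.signed (this.elim (fun h => I.signedKnown_signed m h) id)

end RCanopus
-- Executions: persistence and weak fairness
namespace RCanopus

open State Filter

namespace Execution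

variable {N f k : ℕ} {Tx : Type*} {txs : Fin N → ℕ → Tx} {byz : Finset (Fin N)}
  {e : Execution N f k txs byz} {Q : Finset (Fin N)} {t₀ : ℕ}

theorem grows_succ (e : Execution N f k txs byz) (t : ℕ) :
    (e.state t).Grows (e.state (t + 1)) := by
  rcases h : e.act t with _ | a
  · rw [e.idle t h]
    exact Grows.refl _
  · obtain ⟨h1, h2⟩ := e.step t a h
    rw [h2]
    exact grows_effect txs h1

theorem grows (e : Execution N f k txs byz) {t t' : ℕ} (h : t ≤ t') :
    (e.state t).Grows (e.state t') := by
  induction t', h using Nat.le_induction with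
  | base => exact Grows.refl _
  | succ t' _ ih => exact ih.trans (e.grows_succ t')

theorem invariant (e : Execution N f k txs byz) (t : ℕ) : Invariant f k byz (e.state t) := by
  induction t with
  | zero =>
    rw [e.start]
    exact invariant_init
  | succ t ih =>
    rcases h : e.act t with _ | a
    · rwa [e.idle t h]
    · obtain ⟨h1, h2⟩ := e.step t a h
      rw [h2]
      exact ih.effect txs h1

/-- A property that is preserved as the state grows holds from some moment on if it holds once. -/
theorem eventually_of_grows (e : Execution N f k txs byz) {P : State N Tx → Prop}
    (hP : ∀ s s', State.Grows s s' → P s → P s') {t : ℕ} (h : P (e.state t)) :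
    ∀ᶠ t in atTop, P (e.state t) :=
  eventually_atTop.2 ⟨t, fun _ ht => hP _ _ (e.grows ht) h⟩

/-- Use of weak fairness: a lasting goal is reached if, as long as it is not reached, a fair step is
possible that reaches it. -/
theorem Fair.eventually {a : Action N} (ha : e.Fair a) {P : State N Tx → Prop}
    (hP : ∀ s s', State.Grows s s' → P s → P s')
    (h : ∀ᶠ t in atTop, ¬ P (e.state t) → Enabled f k byz (e.state t) a ∧
      P (effect k txs (e.state t) a)) :
    ∀ᶠ t in atTop, P (e.state t) := by
  obtain ⟨T, hT⟩ := eventually_atTop.1 h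
  obtain ⟨t, ht, hfair⟩ := ha T
  by_cases hp : P (e.state t)
  · exact e.eventually_of_grows hP hp
  · obtain ⟨h1, h2⟩ := hT t ht hp
    have hact := hfair.resolve_left (not_not.2 h1)
    refine e.eventually_of_grows hP (t := t + 1) ?_
    rw [(e.step t a hact).2]
    exact h2

/-! ### Exchange of inputs and reports -/

theorem Timely.eventually_holds (ht : e.Timely Q t₀) {i j : Fin N} (hi : i ∈ Q) (hj : j ∈ Q)
    {c : ℕ} (h : ∀ᶠ t in atTop, (e.state t).Begun j c) :
    ∀ᶠ t in atTop, j ∈ (e.state t).holds i c := by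
  refine (ht.recvInput i hi j hj c).eventually (P := fun s => j ∈ s.holds i c)
    (fun s s' G h => G.holds i c h) ?_
  filter_upwards [h] with t h hn
  exact ⟨⟨h, hn⟩, mem_upd_insert.2 (Or.inl ⟨rfl, rfl, rfl⟩)⟩

theorem Timely.eventually_report (ht : e.Timely Q t₀) (hlive : ∀ i, e.BGLive i)
    (hQ : 2 * f + 1 ≤ Q.card) {c : ℕ}
    (hb : ∀ i ∈ Q, ∀ᶠ t in atTop, (e.state t).Begun i c) {i : Fin N} (hi : i ∈ Q) :
    ∀ᶠ t in atTop, (e.state t).report i c ≠ none := by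
  have hQh : ∀ᶠ t in atTop, ∀ j ∈ Q, j ∈ (e.state t).holds i c :=
    (Finset.eventually_all Q).2 fun j hj => ht.eventually_holds hi hj (hb j hj)
  -- The third alternative is needed because an issued report disables the timers.
  have hout : ∀ᶠ t in atTop, ∀ j, j ∈ (e.state t).holds i c ∨ j ∈ (e.state t).timedOut i c ∨
      (e.state t).report i c ≠ none := by
    refine eventually_all.2 fun j => ?_
    by_cases hj : j ∈ Q
    · filter_upwards [hQh] with t h
      exact Or.inl (h j hj)
    · refine (ht.timeout i hi j hj c).eventually
        (P := fun s => j ∈ s.holds i c ∨ j ∈ s.timedOut i c ∨ s.report i c ≠ none)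
        (fun s s' G h => h.imp (fun h => G.holds i c h)
          (Or.imp (fun h => G.timedOut i c h) G.report_ne_none)) ?_
      filter_upwards [hb i hi] with t h hn
      simp only [not_or, not_not] at hn
      exact ⟨⟨h, hn.2.2, hn.1, hn.2.1⟩,
        Or.inr (Or.inl (mem_upd_insert.2 (Or.inl ⟨rfl, rfl, rfl⟩)))⟩
  refine ((hlive i).reports c).eventually (P := fun s => s.report i c ≠ none)
    (fun s s' G h => G.report_ne_none h) ?_
  filter_upwards [hb i hi, hQh, hout] with t h1 h2 h3 hn
  refine ⟨⟨h1, not_not.1 hn, hQ.trans (Finset.card_le_card fun j hj => h2 j hj), fun j => ?_⟩, ?_⟩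
  · rcases h3 j with h | h | h
    · exact Or.inl h
    · exact Or.inr h
    · exact absurd h hn
  · simp [effect, upd]

theorem Timely.eventually_known (ht : e.Timely Q t₀) {m j : Fin N} (hm : m ∈ Q) (hj : j ∈ Q)
    {c : ℕ} (h : ∀ᶠ t in atTop, (e.state t).report j c ≠ none) :
    ∀ᶠ t in atTop, j ∈ (e.state t).known m c := by
  refine (ht.recvReport m hm j hj c).eventually (P := fun s => j ∈ s.known m c)
    (fun s s' G h => G.known m c h) ?_
  filter_upwards [h] with t h hn
  exact ⟨⟨h, hn⟩, mem_upd_insert.2 (Or.inl ⟨rfl, rfl, rfl⟩)⟩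

/-- Relaying matters for BGs outside `Q`, whose reports may reach only some CM nodes of `Q`
directly. -/
theorem Timely.eventually_known_of_known (ht : e.Timely Q t₀) {m m' j : Fin N} (hm : m ∈ Q)
    (hm' : m' ∈ Q) {c t : ℕ} (h : j ∈ (e.state t).known m' c) :
    ∀ᶠ t in atTop, j ∈ (e.state t).known m c := by
  refine (ht.relayReport m hm m' hm' j c).eventually (P := fun s => j ∈ s.known m c)
    (fun s s' G h => G.known m c h) ?_
  filter_upwards [e.eventually_of_grows (P := fun s => j ∈ s.known m' c)
    (fun s s' G h => G.known m' c h) h] with t h hn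
  exact ⟨⟨h, hn⟩, mem_upd_insert.2 (Or.inl ⟨rfl, rfl, rfl⟩)⟩

/-- The reports of `Q` meet the threshold `2f+1` for suspecting, and a report that never arrives
cannot disable the timer. -/
theorem Timely.eventually_suspicionKnown (ht : e.Timely Q t₀) (hQ : 2 * f + 1 ≤ Q.card)
    {c : ℕ} (hr : ∀ i ∈ Q, ∀ᶠ t in atTop, (e.state t).report i c ≠ none) {j : Fin N}
    (hj : ∀ t, ∀ m ∈ Q, j ∉ (e.state t).known m c) {m m' : Fin N} (hm : m ∈ Q) (hm' : m' ∈ Q) :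
    ∀ᶠ t in atTop, (m', c, j) ∈ (e.state t).suspicion ∧
      (m', c, j) ∈ (e.state t).suspicionKnown m := by
  have hk : ∀ᶠ t in atTop, ∀ i ∈ Q, i ∈ (e.state t).known m' c :=
    (Finset.eventually_all Q).2 fun i hi => ht.eventually_known hm' hi (hr i hi)
  -- Timers are assumed to expire only for BGs outside `Q`; reports from inside do arrive.
  have hjQ : j ∉ Q := fun h => by
    obtain ⟨t, ht⟩ := hk.exists
    exact hj t m' hm' (ht j h)
  have hs : ∀ᶠ t in atTop, (m', c, j) ∈ (e.state t).suspicion := by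
    refine (ht.suspect m' hm' j hjQ c).eventually (P := fun s => (m', c, j) ∈ s.suspicion)
      (fun s s' G h => G.suspicion h) ?_
    filter_upwards [hk] with t h hn
    exact ⟨⟨hn, Or.inr ⟨hQ.trans (Finset.card_le_card h), hj t m' hm'⟩⟩, Set.mem_insert _ _⟩
  refine hs.and ?_
  refine (ht.recvSuspicion m hm m' hm' j c).eventually
    (P := fun s => (m', c, j) ∈ s.suspicionKnown m) (fun s s' G h => G.suspicionKnown m h) ?_
  filter_upwards [hs] with t h hn
  exact ⟨⟨h, hn⟩, mem_update_insert.2 (Or.inl ⟨rfl, rfl⟩)⟩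

/-! ### The log and its replicas -/

/-- The log may grow forever, so a replica is only required to reach a fixed length `n`, one entry
at a time. -/
theorem Timely.eventually_executed (ht : e.Timely Q t₀) {m : Fin N} (hm : m ∈ Q) {n t : ℕ}
    (h : n ≤ (e.state t).log.length) : ∀ᶠ t in atTop, n ≤ (e.state t).executed m := by
  induction n with
  | zero => simp
  | succ n ih =>
    refine (ht.execute m hm).eventually (P := fun s => n + 1 ≤ s.executed m)
      (fun s s' G h => h.trans (G.executed m)) ?_
    filter_upwards [ih (by omega), e.eventually_of_grows
      (P := fun s => n + 1 ≤ s.log.length) (fun s s' G h => h.trans G.log.length_le) h]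
      with t h1 h2 hn
    have hlt : (e.state t).executed m < (e.state t).log.length := by omega
    exact ⟨hlt, by simpa [effect] using h1⟩

/-- Every replica in `Q` catches up with the log. -/
theorem Timely.eventually_replica (ht : e.Timely Q t₀) {m : Fin N} (hm : m ∈ Q) {t c : ℕ}
    {x : Cmd N} (h : RSM.run f k (e.state t).log c = some x) :
    ∀ᶠ t in atTop, (e.state t).replica f k m c = some x := by
  filter_upwards [ht.eventually_executed hm (le_refl (e.state t).log.length),
    eventually_ge_atTop t] with t' h1 h2
  refine RSM.extends_run_of_prefix ?_ _ _ h
  exact List.prefix_take_iff.2 ⟨(e.grows h2).log, h1⟩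

/-- A valid command is ordered eventually. -/
theorem Timely.eventually_log (ht : e.Timely Q t₀) {m : Fin N} (hm : m ∈ Q) {x : Cmd N}
    (h : ∀ᶠ t in atTop, (m, x) ∉ (e.state t).submitted →
      Enabled f k byz (e.state t) (.submit m x)) :
    ∀ᶠ t in atTop, (m, x) ∈ (e.state t).log := by
  have hs : ∀ᶠ t in atTop, (m, x) ∈ (e.state t).submitted := by
    refine (ht.submit m hm x).eventually (P := fun s => (m, x) ∈ s.submitted)
      (fun s s' G h => G.submitted h) ?_
    filter_upwards [h] with t h hn
    exact ⟨h hn, Set.mem_insert _ _⟩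
  refine (ht.order m hm x).eventually (P := fun s => (m, x) ∈ s.log)
    (fun s s' G h => G.log.subset h) ?_
  filter_upwards [hs] with t h hn
  exact ⟨⟨h, hn⟩, by simp [effect]⟩

/-- All signatures of `Q` on a decision are made and exchanged. -/
theorem Timely.eventually_certified (ht : e.Timely Q t₀) (hQ : 2 * f + 1 ≤ Q.card)
    {m : Fin N} (hm : m ∈ Q) {t : ℕ} {x : Cmd N}
    (h : RSM.run f k (e.state t).log x.cycle = some x) :
    ∀ᶠ t in atTop, (e.state t).Certified f m x := by
  have hk : ∀ᶠ t in atTop, ∀ m' ∈ Q, (m', x) ∈ (e.state t).signedKnown m := by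
    refine (Finset.eventually_all Q).2 fun m' hm' => ?_
    have hs : ∀ᶠ t in atTop, (m', x) ∈ (e.state t).signed := by
      refine (ht.sign m' hm' x).eventually (P := fun s => (m', x) ∈ s.signed)
        (fun s s' G h => G.signed h) ?_
      filter_upwards [ht.eventually_replica hm' h] with t h hn
      exact ⟨⟨hn, Or.inr h⟩, Set.mem_insert _ _⟩
    refine (ht.recvSignature m hm m' hm' x).eventually
      (P := fun s => (m', x) ∈ s.signedKnown m) (fun s s' G h => G.signedKnown m h) ?_
    filter_upwards [hs] with t h hn
    exact ⟨⟨h, hn⟩, mem_update_insert.2 (Or.inl ⟨rfl, rfl⟩)⟩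
  filter_upwards [hk] with t h
  exact ⟨Q, by omega, h⟩

end Execution

/-! ### Quorum intersection and the content of decisions -/

/-- A set with more than `f` elements meets a quorum. -/
theorem exists_mem_quorum {N f : ℕ} {Q : Finset (Fin N)} (hQf : (Finset.univ \ Q).card ≤ f)
    {S : Finset (Fin N)} (hS : f + 1 ≤ S.card) : ∃ m ∈ S, m ∈ Q := by
  by_contra! h
  have : S ⊆ Finset.univ \ Q := fun m hm => by simp [h m hm]
  have := Finset.card_le_card this
  omega

namespace Invariant

variable {N f k : ℕ} {Tx : Type*} {byz Q : Finset (Fin N)} {s : State N Tx}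

/-- A response of the CM is the decision recorded by the state machine. -/
theorem run_of_response (I : Invariant f k byz s) (hbyz : Disjoint Q byz)
    (hQf : (Finset.univ \ Q).card ≤ f) {i : Fin N} {c : ℕ} {x : Cmd N}
    (h : s.response i c = some x) : RSM.run f k s.log c = some x := by
  obtain ⟨S, hS, hx⟩ := I.response_certified i c x h
  obtain ⟨m, hm, hmQ⟩ := exists_mem_quorum hQf hS
  rw [← I.response_cycle i c x h]
  exact I.signed_decided m x (Finset.disjoint_left.1 hbyz hmQ)
    (I.signedKnown_signed i (hx m hm))

theorem authentic_of_run (I : Invariant f k byz s) {c : ℕ} {r : Reply N}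
    (h : RSM.run f k s.log c = some (.reply r)) :
    r.cycle = c ∧ s.Authentic r ∧ r.WellFormed f := by
  obtain ⟨h1, ⟨m, hm⟩, h2⟩ := RSM.run_spec h
  exact ⟨h1, I.submitted_authentic m r (I.log_submitted _ hm), h2.1⟩

end Invariant

theorem Reply.mem_live {N : ℕ} {r : Reply N} {j : Fin N} : j ∈ r.live ↔ r.reports j ≠ none := by
  simp [Reply.live]

/-- A member of the outcome is reported by every other non-failed BG. -/
theorem Reply.edge_of_mem_outcome {N : ℕ} {r : Reply N} {i j : Fin N} (hj : j ∈ r.outcome)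
    (hi : i ∈ r.live) (hij : i ≠ j) : r.Edge j i := by
  classical
  simp only [Reply.outcome, Finset.mem_filter] at hj
  by_contra hn
  -- Without the edge to `i`, the out-neighbours of `j` avoid both `i` and `j`, leaving a degree of
  -- at most the number of non-failed BGs minus two.
  have hsub : (r.live.filter fun i => r.Edge j i) ⊆ (r.live.erase j).erase i := by
    intro l hl
    obtain ⟨h1, h2⟩ := Finset.mem_filter.1 hl
    refine Finset.mem_erase.2 ⟨?_, Finset.mem_erase.2 ⟨h2.1, h1⟩⟩
    rintro rfl
    exact hn h2
  have h1 := Finset.card_le_card hsub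
  have h2 : r.live.card - 1 ≤ (r.live.filter fun i => r.Edge j i).card := by
    have := hj.2
    unfold Reply.outDegree at this
    convert this
  have hi' : i ∈ r.live.erase j := Finset.mem_erase.2 ⟨hij, hi⟩
  rw [Finset.card_erase_of_mem hi', Finset.card_erase_of_mem hj.1] at h1
  -- This keeps the second natural-number subtraction from being truncated.
  have h3 := Finset.card_pos.2 ⟨i, hi'⟩
  rw [Finset.card_erase_of_mem hj.1] at h3
  omega

end RCanopus
-- Every request of the quorum is decided
namespace RCanopus

open State Filter

namespace Execution

variable {N f k : ℕ} {Tx : Type*} {txs : Fin N → ℕ → Tx} {byz : Finset (Fin N)}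
  {e : Execution N f k txs byz} {Q : Finset (Fin N)} {t₀ : ℕ}

theorem Timely.eventually_replica_assisted (ht : e.Timely Q t₀) {m : Fin N} (hm : m ∈ Q)
    {t c : ℕ} (h : (RSM.run f k (e.state t).log).Assisted c) :
    ∀ᶠ t in atTop, ((e.state t).replica f k m).Assisted c := by
  obtain ⟨r, hr⟩ := h
  filter_upwards [ht.eventually_replica hm hr] with t h
  exact ⟨r, h⟩

/-- When a quorum has begun cycle `c`, the replicas get to know that the outcome of a cycle that
precedes `c` by `k` or more is settled, unless the quorum issued complete reports for it. -/
theorem Timely.eventually_settled (ht : e.Timely Q t₀) (hbyz : Disjoint Q byz)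
    (hQf : (Finset.univ \ Q).card ≤ f) {c c' T : ℕ} (hc : c' + k ≤ c)
    (hb : ∀ i ∈ Q, (e.state T).Begun i c) {m : Fin N} (hm : m ∈ Q) :
    (∀ j ∈ Q, (e.state T).report j c' = some Finset.univ) ∨
      ∀ᶠ t in atTop, ((e.state t).replica f k m).Assisted c' ∨
        ∃ c'', c' + k ≤ c'' ∧ ((e.state t).replica f k m).Assisted c'' := by
  by_cases hall : ∀ j ∈ Q, (e.state T).report j c' = some Finset.univ
  · exact Or.inl hall
  push Not at hall
  obtain ⟨j, hj, hne⟩ := hall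
  right
  have I := e.invariant T
  have hbeg : (e.state T).Begun j (c' + k) := by
    rcases hc.lt_or_eq with h | h
    · exact I.begun_lt j c (hb j hj) _ h
    · exact h ▸ hb j hj
  -- BG `j` has begun `c' + k`, so it completed `c'`; lacking a complete report, it did so by a
  -- response. Assistance settles `c'` itself, and a denial was valid only because a cycle `≥ c' +
  -- k` had been assisted.
  obtain ⟨R, hR, hu | ⟨r, hr, -⟩ | ⟨c₁, hr, -⟩⟩ := completed_iff.1 (I.begun_completed j c' hbeg)
  · exact absurd (hu ▸ hR) hne
  · filter_upwards [ht.eventually_replica_assisted hm ⟨r, I.run_of_response hbyz hQf hr⟩] with t h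
    exact Or.inl h
  · have hc₁ : c₁ = c' := I.response_cycle _ _ _ hr
    subst hc₁
    obtain ⟨c'', h1, h2⟩ := (RSM.run_spec (I.run_of_response hbyz hQf hr)).2.2
    filter_upwards [ht.eventually_replica_assisted hm h2] with t h
    exact Or.inr ⟨c'', h1, h⟩

/-- A denial is decided if a cycle that makes assistance impossible has been assisted. -/
theorem Timely.exists_decided_of_later (ht : e.Timely Q t₀) (hbyz : Disjoint Q byz) {c : ℕ}
    {i : Fin N} (hi : i ∈ Q) (hreq : ∀ᶠ t in atTop, (e.state t).Requests i c)
    {t c' : ℕ} (hc' : c + k ≤ c') (hA : (RSM.run f k (e.state t).log).Assisted c') :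
    ∃ t x, RSM.run f k (e.state t).log c = some x := by
  by_contra! hnone
  have hnone' : ∀ t, RSM.run f k (e.state t).log c = none := fun t =>
    Option.eq_none_iff_forall_ne_some.2 (hnone t)
  have hk : ∀ᶠ t in atTop, i ∈ (e.state t).known i c := ht.eventually_known hi hi <| by
    filter_upwards [hreq] with t ⟨R, hR, _⟩
    simp [hR]
  have hlog : ∀ᶠ t in atTop, (i, Cmd.deny c) ∈ (e.state t).log := by
    refine ht.eventually_log hi ?_
    filter_upwards [hreq, hk, ht.eventually_replica_assisted hi hA] with t h1 h2 h3 hn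
    refine ⟨hn, Or.inr ⟨⟨i, h2, h1⟩, Option.eq_none_iff_forall_ne_some.2 fun x hx => ?_,
      c', hc', h3⟩⟩
    exact hnone t x (replica_extends _ _ _ _ hx)
  obtain ⟨t', h⟩ := hlog.exists
  rcases (e.invariant t').log_obsolete _ _ (Finset.disjoint_left.1 hbyz hi) h with h | ⟨r, h, -⟩
  · exact h (hnone' t')
  · cases h

/-- A reply is decided if no cycle that makes assistance impossible has been assisted. -/
theorem Timely.exists_decided_of_not_later (ht : e.Timely Q t₀) (hbyz : Disjoint Q byz)
    (hQ : 2 * f + 1 ≤ Q.card) (hQf : (Finset.univ \ Q).card ≤ f) {c : ℕ}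
    (hb : ∀ i ∈ Q, ∀ᶠ t in atTop, (e.state t).Begun i c)
    (hr : ∀ i ∈ Q, ∀ᶠ t in atTop, (e.state t).report i c ≠ none)
    {i : Fin N} (hi : i ∈ Q) (hreq : ∀ᶠ t in atTop, (e.state t).Requests i c)
    (hA : ∀ t c', c + k ≤ c' → ¬ (RSM.run f k (e.state t).log).Assisted c') :
    ∃ t x, RSM.run f k (e.state t).log c = some x := by
  classical
  by_contra! hnone
  have hnone' : ∀ t, RSM.run f k (e.state t).log c = none := fun t =>
    Option.eq_none_iff_forall_ne_some.2 (hnone t)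
  -- `K` is defined by the whole execution: a report from `K` eventually reaches `i` by relaying,
  -- and a BG outside `K` ends up suspected by all of `Q`. So every BG is either used or certified
  -- as failed.
  let K : Finset (Fin N) := Finset.univ.filter fun j => ∃ t, ∃ m ∈ Q, j ∈ (e.state t).known m c
  have hK : ∀ᶠ t in atTop, ∀ j ∈ K, j ∈ (e.state t).known i c := by
    refine (Finset.eventually_all K).2 fun j hj => ?_
    obtain ⟨-, t, m, hm, h⟩ := Finset.mem_filter.1 hj
    exact ht.eventually_known_of_known hi hm h
  have hKc : ∀ j ∉ K, ∀ t, ∀ m ∈ Q, j ∉ (e.state t).known m c := fun j hj t m hm h =>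
    hj (Finset.mem_filter.2 ⟨Finset.mem_univ _, t, m, hm, h⟩)
  have hQK : Q ⊆ K := fun j hj => by
    obtain ⟨t, h⟩ := (ht.eventually_known hj hj (hr j hj)).exists
    exact Finset.mem_filter.2 ⟨Finset.mem_univ _, t, j, hj, h⟩
  obtain ⟨T, hT⟩ := (hK.and (hreq.and ((Finset.eventually_all Q).2 hb))).exists
  obtain ⟨hTK, ⟨R, hR, hRu⟩, hTb⟩ := hT
  have I := e.invariant T
  -- Fairness concerns one fixed command, so the reply is frozen at time `T`, before its failure
  -- certificates need exist. All of `Q` signs these, and `prior` gathers every complete report of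
  -- `Q` up to cycle `c`.
  let r : Reply N :=
    { cycle := c
      reports := fun j => if j ∈ K then (e.state T).report j c else none
      failCert := fun j => if j ∈ K then ∅ else Q
      prior := (Finset.range (c + 1) ×ˢ Q).filter fun p =>
        (e.state T).report p.2 p.1 = some Finset.univ }
  have hlive : r.live = K := by
    ext j
    rw [Reply.mem_live]
    by_cases hj : j ∈ K
    · simpa [r, hj] using I.known_report _ _ _ (hTK j hj)
    · simp [r, hj]
  have hwf : r.WellFormed f := by
    refine ⟨hlive ▸ hQ.trans (Finset.card_le_card hQK), ⟨i, R, by simp [r, hQK hi, hR], hRu⟩, ?_⟩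
    intro j hj
    rw [hlive] at hj
    simp only [r, hj, if_false]
    omega
  have hprior : ∀ {c' j}, (c', j) ∈ r.prior ↔
      c' ≤ c ∧ j ∈ Q ∧ (e.state T).report j c' = some Finset.univ := by
    intro c' j
    simp [r, and_assoc]
  have hsusp : ∀ᶠ t in atTop, ∀ j, ∀ m ∈ r.failCert j,
      (m, c, j) ∈ (e.state t).suspicion ∧ (m, c, j) ∈ (e.state t).suspicionKnown i := by
    refine eventually_all.2 fun j => (Finset.eventually_all (r.failCert j)).2 fun m hm => ?_
    by_cases hj : j ∈ K
    · simp [r, hj] at hm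
    · simp only [r, hj, if_false] at hm
      exact ht.eventually_suspicionKnown hQ hr (hKc j hj) hi hm
  have hpriorKnown : ∀ᶠ t in atTop, ∀ p ∈ r.prior, p.2 ∈ (e.state t).known i p.1 := by
    refine (Finset.eventually_all r.prior).2 fun p hp => ?_
    obtain ⟨-, hj, hu⟩ := hprior.1 hp
    exact ht.eventually_known hi hj (e.eventually_of_grows
      (P := fun s => s.report p.2 p.1 ≠ none) (fun s s' G h => G.report_ne_none h) (t := T)
      (by simp [hu]))
  have hsettled : ∀ᶠ t in atTop, ∀ c' ∈ Finset.range (c + 1), c' + k ≤ c →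
      ((e.state t).replica f k i).Assisted c' ∨ 2 * f + 1 ≤ (r.completeFor c').card ∨
        ∃ c'', c' + k ≤ c'' ∧ ((e.state t).replica f k i).Assisted c'' := by
    refine (Finset.eventually_all (Finset.range (c + 1))).2 fun c' hc' => ?_
    by_cases hck : c' + k ≤ c
    · rcases ht.eventually_settled hbyz hQf hck hTb hi with h | h
      · refine Eventually.of_forall fun t _ => Or.inr (Or.inl (hQ.trans ?_))
        refine Finset.card_le_card fun j hj => ?_
        exact Finset.mem_filter.2 ⟨Finset.mem_univ _, hprior.2 ⟨by omega, hj, h j hj⟩⟩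
      · filter_upwards [h] with t h _
        exact h.imp id Or.inr
    · exact Eventually.of_forall fun t h => absurd h hck
  have hlog : ∀ᶠ t in atTop, (i, Cmd.reply r) ∈ (e.state t).log := by
    refine ht.eventually_log hi ?_
    filter_upwards [eventually_ge_atTop T, hsusp, hpriorKnown, hsettled] with t h1 h2 h3 h4 hn
    have G := e.grows h1
    refine ⟨hn, ⟨fun j R hR => ?_, fun j m hm => (h2 j m hm).1, fun c' j hj =>
      G.report _ _ _ (hprior.1 hj).2.2⟩, Or.inr ⟨⟨fun j hj => ?_, fun j m hm => (h2 j m hm).2,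
        fun c' j hj => h3 _ hj⟩, ?_, ?_, hwf, fun c' hc' => ?_⟩⟩
    · by_cases hj : j ∈ K
      · exact G.report _ _ _ (by simpa [r, hj] using hR)
      · simp [r, hj] at hR
    · exact G.known _ _ (hTK j (hlive ▸ Reply.mem_live.2 hj))
    · exact Option.eq_none_iff_forall_ne_some.2 fun x hx =>
        hnone t x (replica_extends _ _ _ _ hx)
    · exact fun c' hc' h => hA t c' hc' ((replica_extends _ _).assisted h)
    · have hc'' : c' + k ≤ c := hc'
      exact h4 c' (Finset.mem_range.2 (by omega)) hc''
  obtain ⟨t', h⟩ := hlog.exists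
  -- Both ways of being obsolete are excluded: the cycle is never decided and no later cycle that
  -- blocks it is ever assisted.
  rcases (e.invariant t').log_obsolete _ _ (Finset.disjoint_left.1 hbyz hi) h with
    h | ⟨r', h, c', hc', h'⟩
  · exact h (hnone' t')
  · cases h
    exact hA t' c' hc' h'

/-- A BG of the quorum that requests assistance gets a response. -/
theorem Timely.eventually_response (ht : e.Timely Q t₀) (hbyz : Disjoint Q byz)
    (hQ : 2 * f + 1 ≤ Q.card) (hQf : (Finset.univ \ Q).card ≤ f) {c : ℕ}
    (hb : ∀ i ∈ Q, ∀ᶠ t in atTop, (e.state t).Begun i c)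
    (hr : ∀ i ∈ Q, ∀ᶠ t in atTop, (e.state t).report i c ≠ none)
    {i : Fin N} (hi : i ∈ Q) (hreq : ∀ᶠ t in atTop, (e.state t).Requests i c) :
    ∀ᶠ t in atTop, (e.state t).response i c ≠ none := by
  have hdec : ∃ t x, RSM.run f k (e.state t).log c = some x := by
    -- The split is over the whole execution, so that the validity of the chosen kind of command
    -- cannot be lost to a later assistance.
    by_cases hA : ∃ t c', c + k ≤ c' ∧ (RSM.run f k (e.state t).log).Assisted c'
    · obtain ⟨t, c', hc', hA⟩ := hA
      exact ht.exists_decided_of_later hbyz hi hreq hc' hA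
    · push Not at hA
      exact ht.exists_decided_of_not_later hbyz hQ hQf hb hr hi hreq hA
  obtain ⟨t, x, hx⟩ := hdec
  obtain rfl := (RSM.run_spec hx).1
  refine (ht.respond i hi x).eventually (P := fun s => s.response i x.cycle ≠ none)
    (fun s s' G h => ?_) ?_
  · obtain ⟨y, hy⟩ := Option.ne_none_iff_exists'.1 h
    simp [G.response _ _ _ hy]
  · filter_upwards [hreq, ht.eventually_known hi hi (hr i hi), ht.eventually_certified hQ hi hx]
      with t h1 h2 h3 hn
    exact ⟨⟨h2, h1, not_not.1 hn, h3⟩, by simp [effect, upd]⟩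

/-! ### Retrieval of inputs and completion of cycles -/

/-- After a response, inputs are retrieved from the quorum. -/
theorem Timely.eventually_retrieved (ht : e.Timely Q t₀) {i h j : Fin N} (hi : i ∈ Q)
    (hh : h ∈ Q) {c t t' : ℕ} (hres : (e.state t).response i c ≠ none)
    (hj : j ∈ (e.state t').holds h c) : ∀ᶠ t in atTop, j ∈ (e.state t).holds i c := by
  obtain ⟨x, hx⟩ := Option.ne_none_iff_exists'.1 hres
  refine (ht.retrieve i hi h hh j c).eventually (P := fun s => j ∈ s.holds i c)
    (fun s s' G h => G.holds i c h) ?_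
  filter_upwards [eventually_ge_atTop t, eventually_ge_atTop t'] with t'' h1 h2 hn
  refine ⟨⟨?_, (e.grows h2).holds _ _ hj, hn⟩, mem_upd_insert.2 (Or.inl ⟨rfl, rfl, rfl⟩)⟩
  simp [(e.grows h1).response _ _ _ hx]

/-- If assistance with a cycle is denied, some BG of the quorum holds all inputs of the cycle. -/
theorem exists_holds_univ_of_denied (e : Execution N f k txs byz) (hbyz : Disjoint Q byz)
    (hQf : (Finset.univ \ Q).card ≤ f) {c t : ℕ}
    (h : RSM.run f k (e.state t).log c = some (.deny c)) :
    ∃ i ∈ Q, (e.state t).holds i c = Finset.univ := by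
  have I := e.invariant t
  obtain ⟨c', hc', r, hr⟩ := (RSM.run_spec h).2.2
  obtain ⟨hrc, hauth, hwf⟩ := I.authentic_of_run hr
  -- The later assisted cycle rests on `2f+1` reports, one of them from `Q`. Its author has begun
  -- that cycle and hence completed `c`, and not by assistance, since the decision for `c` is a
  -- denial.
  obtain ⟨i, hi, hiQ⟩ := exists_mem_quorum hQf (show f + 1 ≤ r.live.card by have := hwf.1; omega)
  obtain ⟨R', hR'⟩ := Option.ne_none_iff_exists'.1 (Reply.mem_live.1 hi)
  have hb : (e.state t).Begun i c' :=
    I.report_begun i c' (by rw [← hrc, hauth.1 i R' hR']; simp)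
  have hbeg : (e.state t).Begun i (c + k) := by
    rcases hc'.lt_or_eq with h | h
    · exact I.begun_lt i c' hb _ h
    · exact h ▸ hb
  refine ⟨i, hiQ, ?_⟩
  obtain ⟨R, hR, rfl | ⟨r', hr', -⟩ | ⟨c₁, -, hu⟩⟩ :=
    completed_iff.1 (I.begun_completed i c hbeg)
  · exact Finset.univ_subset_iff.1 (I.report_subset i c _ hR)
  · rw [I.run_of_response hbyz hQf hr'] at h
    cases h
  · exact hu

/-- A cycle begun by the whole quorum is completed by the whole quorum. -/
theorem Timely.eventually_completed (ht : e.Timely Q t₀) (hlive : ∀ i, e.BGLive i)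
    (hbyz : Disjoint Q byz) (hQ : 2 * f + 1 ≤ Q.card) (hQf : (Finset.univ \ Q).card ≤ f) {c : ℕ}
    (hb : ∀ i ∈ Q, ∀ᶠ t in atTop, (e.state t).Begun i c) {i : Fin N} (hi : i ∈ Q) :
    ∀ᶠ t in atTop, (e.state t).Completed i c := by
  have hr : ∀ i ∈ Q, ∀ᶠ t in atTop, (e.state t).report i c ≠ none := fun i hi =>
    ht.eventually_report hlive hQ hb hi
  obtain ⟨T, hT⟩ := (hr i hi).exists
  obtain ⟨R, hR⟩ := Option.ne_none_iff_exists'.1 hT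
  by_cases hu : R = Finset.univ
  · exact e.eventually_of_grows (P := fun s => s.Completed i c) (fun s s' G h => G.completed h)
      (completed_iff.2 ⟨R, hR, Or.inl hu⟩)
  have hreq : ∀ᶠ t in atTop, (e.state t).Requests i c := e.eventually_of_grows
    (P := fun s => s.Requests i c) (fun s s' G h => G.requests h) (t := T) ⟨R, hR, hu⟩
  obtain ⟨T', hT', hle⟩ :=
    ((ht.eventually_response hbyz hQ hQf hb hr hi hreq).and (eventually_ge_atTop T)).exists
  have I := e.invariant T'
  obtain ⟨x, hx⟩ := Option.ne_none_iff_exists'.1 hT'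
  have hrun := I.run_of_response hbyz hQf hx
  have hR' := (e.grows hle).report _ _ _ hR
  cases x with
  | reply r =>
    obtain ⟨rfl, hauth, hwf⟩ := I.authentic_of_run hrun
    have hout : ∀ᶠ t in atTop, ∀ j ∈ r.outcome, j ∈ (e.state t).holds i r.cycle := by
      refine (Finset.eventually_all r.outcome).2 fun j hj => ?_
      by_cases hjQ : j ∈ Q
      · exact ht.eventually_holds hi hjQ (hb j hjQ)
      -- A BG `j` outside `Q` need not send its input to `i`, but some `h` in `Q` is non-failed and
      -- differs from `j`, so its report lists that input and it can supply a copy.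
      · obtain ⟨h, hh, hhQ⟩ :=
          exists_mem_quorum hQf (show f + 1 ≤ r.live.card by have := hwf.1; omega)
        obtain ⟨-, R', hR', hjR⟩ :=
          Reply.edge_of_mem_outcome hj hh (by rintro rfl; exact hjQ hhQ)
        exact ht.eventually_retrieved hi hhQ hT'
          (I.report_subset h _ R' (hauth.1 h R' hR') hjR)
    filter_upwards [hout, eventually_ge_atTop T'] with t h1 h2
    have G := e.grows h2
    exact completed_iff.2 ⟨R, G.report _ _ _ hR', Or.inr (Or.inl ⟨r, G.response _ _ _ hx, h1⟩)⟩
  | deny c₁ =>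
    obtain rfl : c₁ = c := I.response_cycle _ _ _ hx
    obtain ⟨h, hhQ, hh⟩ := e.exists_holds_univ_of_denied hbyz hQf hrun
    have hall : ∀ᶠ t in atTop, ∀ j, j ∈ (e.state t).holds i c₁ :=
      eventually_all.2 fun j => ht.eventually_retrieved hi hhQ hT' (t' := T') (by simp [hh])
    filter_upwards [hall, eventually_ge_atTop T'] with t h1 h2
    have G := e.grows h2
    exact completed_iff.2 ⟨R, G.report _ _ _ hR',
      Or.inr (Or.inr ⟨c₁, G.response _ _ _ hx, Finset.eq_univ_iff_forall.2 h1⟩)⟩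

/-- The BGs of the quorum begin every cycle. -/
theorem Timely.eventually_begun (ht : e.Timely Q t₀) (hk : 1 ≤ k) (hlive : ∀ i, e.BGLive i)
    (hbyz : Disjoint Q byz) (hQ : 2 * f + 1 ≤ Q.card) (hQf : (Finset.univ \ Q).card ≤ f) (c : ℕ) :
    ∀ i ∈ Q, ∀ᶠ t in atTop, (e.state t).Begun i c := by
  induction c using Nat.strong_induction_on with
  | h c ih =>
    intro i hi
    have hlt : ∀ᶠ t in atTop, ∀ c' ∈ Finset.range c, (e.state t).Begun i c' :=
      (Finset.eventually_all _).2 fun c' hc' => ih c' (Finset.mem_range.1 hc') i hi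
    have hcomp : ∀ᶠ t in atTop, ∀ c', c' + k = c → (e.state t).Completed i c' := by
      by_cases hc : k ≤ c
      -- Here `1 ≤ k` makes `c - k` smaller than `c`, so the induction hypothesis applies to all of
      -- `Q`. For `c < k` no completion is required.
      · filter_upwards [ht.eventually_completed hlive hbyz hQ hQf (ih (c - k) (by omega)) hi]
          with t h c' hc'
        obtain rfl : c' = c - k := by omega
        exact h
      · exact Eventually.of_forall fun t c' hc' => by omega
    refine ((hlive i).begins c).eventually (P := fun s => s.Begun i c)
      (fun s s' G h => G.begun h) ?_
    filter_upwards [hlt, hcomp] with t h1 h2 hn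
    exact ⟨⟨hn, fun c' hc' => h1 c' (Finset.mem_range.2 hc'), h2⟩, by simp [Begun, effect, upd]⟩

end Execution

end RCanopus

open RCanopus in
theorem theorem3 {N f k : ℕ} (hN : 3 * f + 1 ≤ N) (hk : 1 ≤ k)
    {Tx : Type*} (txs : Fin N → ℕ → Tx) (byz : Finset (Fin N))
    (e : Execution N f k txs byz)
    (C : ℕ) (hC : ∃ t i, (e.state t).Begun i C)
    (hlive : ∀ i, e.BGLive i)
    (Q : Finset (Fin N)) (hQ : 2 * f + 1 ≤ Q.card) (hQf : (Finset.univ \ Q).card ≤ f)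
    (hbyz : Disjoint Q byz)
    (t₀ : ℕ) (htimely : e.Timely Q t₀) :
    ∀ i ∈ Q, ∃ t, ∃ c, C + k ≤ c ∧ (e.state t).Begun i c := by
  intro i hi
  obtain ⟨t, ht⟩ := (htimely.eventually_begun hk hlive hbyz hQ hQf (C + k) i hi).exists
  exact ⟨t, C + k, le_rfl, ht⟩
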